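/- Let $n,p\ge 1$, and for $i=1,\dots,n$ let $f_i:\mathbb{R}^{d_i}\to\mathbb{R}$ be $\mu_i$-strongly convex and $l_i$-smooth (differentiable with $l_i$-Lipschitz gradient), where $\mu_i,l_i>0$, and let $A_i\in\mathbb{R}^{p\times d_i}$ and $b\in\mathbb{R}^p$. Write $\mathbf{x}=(x_1,\dots,x_n)$, $A=[A_1,\dots,A_n]$, $\mathbf{A}=\mathrm{diag}(A_1,\dots,A_n)$, $\mu=\min_i\mu_i$, $l=\max_i l_i$; let $\overline{\sigma}(\cdot)$ and $\underline{\sigma}(\cdot)$ denote the largest and the smallest non-zero singular value, and assume $A\neq 0$ (so that $\underline{\sigma}(A)$ exists). Let $\mathbf{x}^*$ be a solution of $$\min_{x_i\in\mathbb{R}^{d_i}}\ \sum_{i=1}^n f_i(x_i)\quad\text{s.t.}\quad \sum_{i=1}^n A_ix_i=b .$$ Let $W\in\mathbb{R}^{n\times n}$ be primitive and doubly stochastic with positive diagonal entries (not necessarily symmetric), and let $\sigma=\|W-\frac1n\mathbf{1}\mathbf{1}^{\top}\|$ (spectral norm). Let $\gamma\in(0,1)$, let the real sequence $(\delta^k)_{k\ge0}$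 satisfy $\delta^{k+1}=\gamma\delta^k$ for all $k\ge0$, and let $(\mathbf{x}^k,\mathbf{z}^k,\boldsymbol{\lambda}^k)_{k\ge0}$ be iterates of iDDGT with step size $\beta$: $\lambda_i^0=0$; $\mathbf{x}^0$ is arbitrary; $z_i^0=A_ix_i^0-\frac1nb$ (so $z_i^0=-\frac1nb$ for the choice $\mathbf{x}^0=0$); and for all $k\ge 0$ and all $i$, $$\|\mathbf{x}^{k+1}-\mathbf{x}^*(\boldsymbol{\lambda}^k)\|\le\delta^{k+1},\qquad \mathbf{x}^*(\boldsymbol{\lambda})=\arg\min_{\mathbf{x}}\sum_{i=1}^n\Big(f_i(x_i)+\lambda_i^{\top}\big(A_ix_i-\tfrac1nb\big)\Big),$$ $$z_i^{k+1}=\sum_{j=1}^n W_{ij}z_j^k+A_i(x_i^{k+1}-x_i^k),\qquad \lambda_i^{k+1}=\sum_{j=1}^n W_{ij}\big(\lambda_j^k+\beta z_j^{k+1}\big).$$ If the step size satisfies $$0<\beta<\min\left\{\frac{\mu}{\overline{\sigma}^2(\mathbf{A})},\ \frac{(1-\sigma)^2\,\underline{\sigma}^2(A)\,\mu^2}{16\,\overline{\sigma}^4(\mathbf{A})\,n\,l}\right\},$$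 then $$\theta=\max\left(1-\frac{\beta\underline{\sigma}^2(A)}{2nl},\ \sigma+4\sqrt{\beta\,\frac{\overline{\sigma}^4(\mathbf{A})\,n\,l}{\underline{\sigma}^2(A)\mu^2}},\ \gamma\right)\in(0,1)$$ and $$\|\mathbf{x}^k-\mathbf{x}^*\|=\mathcal{O}(\theta^k)\qquad(k\to\infty).$$ -/

import Mathlib

open scoped BigOperators Matrix

noncomputable section

namespace IDDGT

/-- The stacked decision vector `(x_1, …, x_n)` with blocks `x_i ∈ ℝ^{d_i}`, carrying the
Euclidean norm of `ℝ^{d_1 + ⋯ + d_n}`. -/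
abbrev Decision {n : ℕ} (d : Fin n → ℕ) : Type :=
  PiLp 2 (fun i : Fin n => EuclideanSpace ℝ (Fin (d i)))

/-- The aggregate objective `f(x) = ∑ i, f_i(x_i)`. -/
def totalCost {n : ℕ} {d : Fin n → ℕ} (f : ∀ i, EuclideanSpace ℝ (Fin (d i)) → ℝ)
    (x : Decision d) : ℝ :=
  ∑ i, f i (x i)

/-- The horizontally stacked matrix `A = [A_1, …, A_n]`. Its block diagonal companion
`diag(A_1, …, A_n)` is `Matrix.blockDiagonal' A`. -/
def stacked {n p : ℕ} {d : Fin n → ℕ} (A : ∀ i, Matrix (Fin p) (Fin (d i)) ℝ) :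
    Matrix (Fin p) (Σ i, Fin (d i)) ℝ :=
  Matrix.of fun r c => A c.1 r c.2

/-- The largest singular value of a real matrix. -/
def sigmaMax {r c : Type*} [Fintype r] [Fintype c] [DecidableEq r] [DecidableEq c]
    (B : Matrix r c ℝ) : ℝ :=
  (Matrix.toEuclideanLin B).singularValues 0

/-- The smallest non-zero singular value of a (non-zero) real matrix. -/
def sigmaMin {r c : Type*} [Fintype r] [Fintype c] [DecidableEq r] [DecidableEq c]
    (B : Matrix r c ℝ) : ℝ :=
  sInf {s : ℝ | s ≠ 0 ∧ ∃ i : ℕ, (Matrix.toEuclideanLin B).singularValues i = s}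

/-- The spectral norm of `W - (1/n) 1 1ᵀ`. -/
def mixingNorm {n : ℕ} (W : Matrix (Fin n) (Fin n) ℝ) : ℝ :=
  ‖Matrix.toEuclideanCLM (n := Fin n) (𝕜 := ℝ) (W - Matrix.of fun _ _ => (1 / n : ℝ))‖

/-- `g` is `L`-smooth: differentiable with `L`-Lipschitz gradient. -/
def IsSmooth {E : Type*} [NormedAddCommGroup E] [InnerProductSpace ℝ E] [CompleteSpace E]
    (L : ℝ) (g : E → ℝ) : Prop :=
  Differentiable ℝ g ∧ ∀ x y, ‖gradient g x - gradient g y‖ ≤ L * ‖x - y‖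

/-- `x` solves `min ∑ i, f_i(x_i)` subject to `∑ i, A_i x_i = b`. -/
def IsSolution {n p : ℕ} {d : Fin n → ℕ} (f : ∀ i, EuclideanSpace ℝ (Fin (d i)) → ℝ)
    (A : ∀ i, Matrix (Fin p) (Fin (d i)) ℝ) (b : EuclideanSpace ℝ (Fin p))
    (x : Decision d) : Prop :=
  ∑ i, Matrix.toEuclideanLin (A i) (x i) = b ∧
    ∀ y : Decision d, ∑ i, Matrix.toEuclideanLin (A i) (y i) = b →
      totalCost f x ≤ totalCost f y

/-- The objective of the inner problem for local multipliers `lam = (λ_1, …, λ_n)`: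
`∑ i, (f_i(x_i) + λ_iᵀ (A_i x_i - b / n))`. -/
def lagrangian {n p : ℕ} {d : Fin n → ℕ} (f : ∀ i, EuclideanSpace ℝ (Fin (d i)) → ℝ)
    (A : ∀ i, Matrix (Fin p) (Fin (d i)) ℝ) (b : EuclideanSpace ℝ (Fin p))
    (lam : Fin n → EuclideanSpace ℝ (Fin p)) (x : Decision d) : ℝ :=
  ∑ i, (f i (x i) +
    inner ℝ (lam i) (Matrix.toEuclideanLin (A i) (x i) - (1 / n : ℝ) • b))

/-- `(x, z, lam)` is a run of the inexact decentralized dual gradient tracking method with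
mixing matrix `W` and step size `β`, started from zero multipliers, in which the inner problem of
step `k` is solved up to the error `δ (k + 1)`. The value of `x 0` is arbitrary; the choice
`x 0 = 0` gives `z 0 i = - b / n`. -/
structure IsRun {n p : ℕ} {d : Fin n → ℕ} (f : ∀ i, EuclideanSpace ℝ (Fin (d i)) → ℝ)
    (A : ∀ i, Matrix (Fin p) (Fin (d i)) ℝ) (b : EuclideanSpace ℝ (Fin p))
    (W : Matrix (Fin n) (Fin n) ℝ) (β : ℝ) (δ : ℕ → ℝ)
    (x : ℕ → Decision d) (z lam : ℕ → Fin n → EuclideanSpace ℝ (Fin p)) : Prop where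
  lam_zero : ∀ i, lam 0 i = 0
  z_zero : ∀ i, z 0 i = Matrix.toEuclideanLin (A i) (x 0 i) - (1 / n : ℝ) • b
  x_succ : ∀ k, ∃ xs : Decision d,
    (∀ y, lagrangian f A b (lam k) xs ≤ lagrangian f A b (lam k) y) ∧
      ‖x (k + 1) - xs‖ ≤ δ (k + 1)
  z_succ : ∀ k i, z (k + 1) i =
    ∑ j, W i j • z k j + Matrix.toEuclideanLin (A i) (x (k + 1) i - x k i)
  lam_succ : ∀ k i, lam (k + 1) i = ∑ j, W i j • (lam k j + β • z (k + 1) j)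

end IDDGT

end

/-!
The method is an inexact gradient ascent on the dual function, carried out by `n` agents that keep
the local multipliers `Λ = (λ_1, …, λ_n)` and track the constraint violation by `Z`.

All data are stacked. The aggregate objective `F` is strongly convex with modulus `m` and `L`-smooth
on the space of decisions (`totalCost_strongConvexOn`, `totalCost_isSmooth`), `B` is the block
diagonal map with `‖B‖ ≤ S = σ̄(𝐀)` (`norm_blockMap_le`), `P` is the averaging projection and `W`
the mixing operator, with `W P = P W = P` and `‖W - P‖ ≤ σ`. The inner solutions are characterised
by `∇F(x*(Λ)) = -Bᵀ Λ` (`gradient_eq_of_lagrangian_min`), and the solution of the coupled problem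
satisfies the same equation for an averaged multiplier `Λ* = P Λ*` in the range of `P B`
(`IsSolution.exists_multiplier`).

Tracking is exact on average, `P Z^k = P B (x^k - x*)`, so the averaged multiplier performs a
perturbed ascent step and its deviation from `Λ*` never leaves the range of `P B`. There the
averaged dual function is strongly concave with modulus `q = t² / L`, where `t = σ̲(A) / √n`
(`sigmaMin_mul_norm_averaging_le`, and cocoercivity of `∇F`, `IsSmooth.gradient_cocoercive`), and
its gradient is `K`-Lipschitz with `K = S² / m`. As `β K ≤ 1/16`, the exact ascent step contracts
by the factor `1 - (31/32) β q` (`dual_ascent_contraction`), which is strictly better than the rate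
`1 - β q / 2` to be proved.

It remains to follow three errors: `e`, the distance of `P Λ` from `Λ*`; `c`, the disagreement
`‖Λ - P Λ‖`; and `w`, the disagreement `‖Z - P Z‖ / K`. With `τ = √(β q)` and `y = K √(β / q)`, so
that `β K = y τ` and `τ ≤ y < 1/4`, they obey a linear recursion with a non-negative matrix for
which the vector `(3 y, τ, 1)` is a strict sub-eigenvector for every value that is at least
`max (1 - τ² / 2) (σ + 4 y)` (`coupled_recursion_bound`). Strictness absorbs the inner errors
`δ^k = γ^k δ^0`, even where `γ` is the largest of the three rates. The bound on `β` gives `σ < 1`,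
because `σ ≤ 1` holds for every doubly stochastic matrix.
-/

namespace IDDGT

/-! ### Strongly convex functions with Lipschitz gradient -/

section Gradient

variable {E : Type*} [NormedAddCommGroup E] [InnerProductSpace ℝ E] [CompleteSpace E] {g : E → ℝ}

/-- The derivative of a differentiable function along a line, in terms of its gradient. -/
lemma hasDerivAt_comp_line (hg : Differentiable ℝ g) (x v : E) (t : ℝ) :
    HasDerivAt (fun s : ℝ => g (x + s • v)) (inner ℝ (gradient g (x + t • v)) v) t := by
  have h1 : HasDerivAt (fun s : ℝ => x + s • v) v t := by
    simpa using ((hasDerivAt_id t).smul_const v).const_add x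
  rw [inner_gradient_left]
  exact (hg (x + t • v)).hasFDerivAt.comp_hasDerivAt t h1

/-- First order lower bound for a strongly convex function. -/
lemma strongConvexOn_first_order {m : ℝ} (hc : StrongConvexOn Set.univ m g)
    (hg : Differentiable ℝ g) (x y : E) :
    g x + inner ℝ (gradient g x) (y - x) + m / 2 * ‖y - x‖ ^ 2 ≤ g y := by
  have hd : HasDerivAt (fun s : ℝ => g (x + s • (y - x))) (inner ℝ (gradient g x) (y - x)) 0 := by
    simpa using hasDerivAt_comp_line hg x (y - x) 0
  have hlim := hd.tendsto_slope_zero_right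
  have hrhs : Filter.Tendsto (fun t : ℝ => g y - g x - (1 - t) * (m / 2 * ‖y - x‖ ^ 2))
      (nhdsWithin 0 (Set.Ioi 0)) (nhds (g y - g x - (1 - 0) * (m / 2 * ‖y - x‖ ^ 2))) := by
    apply Filter.Tendsto.mono_left _ nhdsWithin_le_nhds
    exact Continuous.tendsto (by fun_prop) 0
  have := le_of_tendsto_of_tendsto hlim hrhs ?_
  · linarith
  filter_upwards [Ioo_mem_nhdsGT (zero_lt_one' ℝ)] with t ht
  have h := hc.2 (Set.mem_univ x) (Set.mem_univ y) (sub_nonneg.2 ht.2.le) ht.1.le (by ring)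
  have he : (1 - t) • x + t • y = x + t • (y - x) := by module
  rw [he, norm_sub_rev x y] at h
  simp only [smul_eq_mul, zero_add, zero_smul, add_zero] at h ⊢
  rw [inv_mul_le_iff₀ ht.1]
  linarith

/-- The gradient of a strongly convex function is strongly monotone. -/
lemma strongConvexOn_gradient_monotone {m : ℝ} (hc : StrongConvexOn Set.univ m g)
    (hg : Differentiable ℝ g) (x y : E) :
    m * ‖x - y‖ ^ 2 ≤ inner ℝ (gradient g x - gradient g y) (x - y) := by
  have h1 := strongConvexOn_first_order hc hg x y
  have h2 := strongConvexOn_first_order hc hg y x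
  rw [norm_sub_rev y x, ← neg_sub x y, inner_neg_right] at h1
  rw [inner_sub_left]
  linarith

/-- The quadratic upper bound ("descent lemma") for an `L`-smooth function. -/
lemma IsSmooth.le_quadratic {L : ℝ} (hs : IsSmooth L g) (x v : E) :
    g (x + v) ≤ g x + inner ℝ (gradient g x) v + L / 2 * ‖v‖ ^ 2 := by
  let φ : ℝ → ℝ := fun t => g (x + t • v) - t * inner ℝ (gradient g x) v - L / 2 * ‖v‖ ^ 2 * t ^ 2
  have hφ : ∀ t, HasDerivAt φ (inner ℝ (gradient g (x + t • v)) v - inner ℝ (gradient g x) v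
      - L / 2 * ‖v‖ ^ 2 * (2 * t)) t := by
    intro t
    refine HasDerivAt.sub (HasDerivAt.sub (hasDerivAt_comp_line hs.1 x v t) ?_) ?_
    · simpa using (hasDerivAt_id t).mul_const (inner ℝ (gradient g x) v)
    · simpa using (hasDerivAt_pow 2 t).const_mul (L / 2 * ‖v‖ ^ 2)
  have hanti : AntitoneOn φ (Set.Icc 0 1) := by
    apply antitoneOn_of_deriv_nonpos (convex_Icc 0 1)
      (fun t _ => (hφ t).continuousAt.continuousWithinAt)
      (fun t _ => (hφ t).differentiableAt.differentiableWithinAt)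
    intro t ht
    rw [interior_Icc] at ht
    rw [(hφ t).deriv, ← inner_sub_left]
    have h1 := real_inner_le_norm (gradient g (x + t • v) - gradient g x) v
    have h2 := hs.2 (x + t • v) x
    rw [add_sub_cancel_left, norm_smul, Real.norm_of_nonneg ht.1.le] at h2
    have h3 := mul_le_mul_of_nonneg_right h2 (norm_nonneg v)
    nlinarith
  have := hanti (Set.left_mem_Icc.2 zero_le_one) (Set.right_mem_Icc.2 zero_le_one) zero_le_one
  simp only [φ, one_smul, zero_smul, add_zero] at this
  linarith

/-- The gradient of a convex `L`-smooth function is `1/L`-cocoercive (Baillon–Haddad). -/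
lemma IsSmooth.gradient_cocoercive {L : ℝ} (hL : 0 < L) (hs : IsSmooth L g)
    (hc : StrongConvexOn Set.univ 0 g) (x y : E) :
    ‖gradient g x - gradient g y‖ ^ 2 ≤ L * inner ℝ (gradient g x - gradient g y) (x - y) := by
  -- Compare the tangent at `y` with the quadratic upper bound at `x`, both at the point reached
  -- from `x` by a gradient step of length `1 / L` for `g - ⟨∇g(y), ·⟩`.
  have key : ∀ x y : E, g y + inner ℝ (gradient g y) (x - y)
      + 1 / (2 * L) * ‖gradient g x - gradient g y‖ ^ 2 ≤ g x := by
    intro x y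
    set D := gradient g x - gradient g y with hD
    have h1 := hs.le_quadratic x (-(1 / L) • D)
    have h2 := strongConvexOn_first_order hc hs.1 y (x + -(1 / L) • D)
    have h3 : x + -(1 / L) • D - y = (x - y) + -(1 / L) • D := by abel
    rw [h3, inner_add_right, inner_smul_right] at h2
    rw [inner_smul_right, norm_smul, mul_pow, Real.norm_eq_abs, sq_abs] at h1
    have h4 : ‖D‖ ^ 2 = inner ℝ (gradient g x) D - inner ℝ (gradient g y) D := by
      rw [← inner_sub_left, ← hD, real_inner_self_eq_norm_sq]
    have h5 : L / 2 * ((-(1 / L)) ^ 2 * ‖D‖ ^ 2) = 1 / (2 * L) * ‖D‖ ^ 2 := by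
      field_simp
    have h6 : (1 / L) * ‖D‖ ^ 2 = 2 * (1 / (2 * L) * ‖D‖ ^ 2) := by
      field_simp
    rw [h5] at h1
    have h7 := congrArg (fun r => (1 / L) * r) h4
    simp only [mul_sub] at h7
    linarith
  have h1 := key x y
  have h2 := key y x
  rw [norm_sub_rev (gradient g y), ← neg_sub x y, inner_neg_right] at h2
  rw [inner_sub_left]
  have h3 : 2 * (1 / (2 * L) * ‖gradient g x - gradient g y‖ ^ 2)
      = ‖gradient g x - gradient g y‖ ^ 2 / L := by
    field_simp
  have h4 : ‖gradient g x - gradient g y‖ ^ 2 / L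
      ≤ inner ℝ (gradient g x) (x - y) - inner ℝ (gradient g y) (x - y) := by linarith
  rwa [div_le_iff₀' hL] at h4

end Gradient

/-! ### Extreme singular values -/

section SingularValues

variable {E F : Type*} [NormedAddCommGroup E] [InnerProductSpace ℝ E] [FiniteDimensional ℝ E]
  [NormedAddCommGroup F] [InnerProductSpace ℝ F] [FiniteDimensional ℝ F]

open Module in
/-- `‖T x‖²` and `‖T* T x‖²` in the eigenbasis of `T* T`: the weights of the squared coordinates
are the second and fourth powers of the singular values. -/
lemma norm_sq_eq_sum_singularValues (T : E →ₗ[ℝ] F) (x : E) :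
    ∃ c : Fin (finrank ℝ E) → ℝ, ‖x‖ ^ 2 = ∑ i, c i ^ 2 ∧
      ‖T x‖ ^ 2 = ∑ i : Fin (finrank ℝ E), T.singularValues i ^ 2 * c i ^ 2 ∧
      ‖LinearMap.adjoint T (T x)‖ ^ 2 =
        ∑ i : Fin (finrank ℝ E), T.singularValues i ^ 4 * c i ^ 2 := by
  let hS := T.isSymmetric_adjoint_comp_self
  let B := hS.eigenvectorBasis rfl
  have hrepr : ∀ i, B.repr (LinearMap.adjoint T (T x)) i = T.singularValues i ^ 2 * B.repr x i := by
    intro i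
    rw [T.sq_singularValues_fin rfl i]
    exact hS.eigenvectorBasis_apply_self_apply rfl x i
  refine ⟨fun i => B.repr x i, ?_, ?_, ?_⟩
  · rw [← B.repr.norm_map, EuclideanSpace.real_norm_sq_eq]
  · rw [← real_inner_self_eq_norm_sq, ← LinearMap.adjoint_inner_left, ← B.repr.inner_map_map,
      PiLp.inner_apply]
    refine Finset.sum_congr rfl fun i _ => ?_
    rw [hrepr]
    simp
    ring
  · rw [← B.repr.norm_map, EuclideanSpace.real_norm_sq_eq]
    refine Finset.sum_congr rfl fun i _ => ?_
    rw [hrepr]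
    ring

variable {r c : Type*} [Fintype r] [Fintype c] [DecidableEq r] [DecidableEq c]

lemma sigmaMax_nonneg (B : Matrix r c ℝ) : 0 ≤ sigmaMax B := LinearMap.singularValues_nonneg _ _

lemma sigmaMin_nonneg (B : Matrix r c ℝ) : 0 ≤ sigmaMin B := by
  apply Real.sInf_nonneg
  rintro s ⟨-, i, rfl⟩
  exact LinearMap.singularValues_nonneg _ _

lemma norm_toEuclideanLin_le_sigmaMax (B : Matrix r c ℝ) (x : EuclideanSpace ℝ c) :
    ‖Matrix.toEuclideanLin B x‖ ≤ sigmaMax B * ‖x‖ := by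
  obtain ⟨a, h1, h2, -⟩ := norm_sq_eq_sum_singularValues (Matrix.toEuclideanLin B) x
  refine le_of_sq_le_sq ?_ (mul_nonneg (sigmaMax_nonneg B) (norm_nonneg x))
  rw [mul_pow, h1, h2, Finset.mul_sum]
  refine Finset.sum_le_sum fun i _ => ?_
  gcongr
  · exact LinearMap.singularValues_nonneg _ _
  · exact LinearMap.singularValues_antitone _ (Nat.zero_le _)

/-- On the range of `B`, the adjoint expands norms by at least the smallest non-zero singular
value. -/
lemma sigmaMin_mul_norm_le (B : Matrix r c ℝ) (x : EuclideanSpace ℝ c) :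
    sigmaMin B * ‖Matrix.toEuclideanLin B x‖ ≤
      ‖LinearMap.adjoint (Matrix.toEuclideanLin B) (Matrix.toEuclideanLin B x)‖ := by
  obtain ⟨a, -, h1, h2⟩ := norm_sq_eq_sum_singularValues (Matrix.toEuclideanLin B) x
  refine le_of_sq_le_sq ?_ (norm_nonneg _)
  rw [mul_pow, h1, h2, Finset.mul_sum]
  refine Finset.sum_le_sum fun i _ => ?_
  set s := (Matrix.toEuclideanLin B).singularValues i with hs
  by_cases h0 : s = 0
  · simp [h0]
  have hle : sigmaMin B ≤ s :=
    csInf_le ⟨0, by rintro _ ⟨-, j, rfl⟩; exact LinearMap.singularValues_nonneg _ _⟩ ⟨h0, i, rfl⟩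
  have h3 : sigmaMin B ^ 2 ≤ s ^ 2 := by
    gcongr
    exact sigmaMin_nonneg B
  have : s ^ 4 * a i ^ 2 = s ^ 2 * (s ^ 2 * a i ^ 2) := by ring
  rw [this]
  gcongr

end SingularValues

/-! ### Dual gradient tracking for an averaging operator on a Euclidean space -/

/-- Contraction of the three coupled error recursions. The weights `3y`, `τ`, `1` form a strict
sub-eigenvector, for the value `θ`, of the non-negative matrix of the recursion; the strictness is
what allows a perturbation that decays at the very rate `θ`. -/
lemma coupled_recursion_bound {y τ σ θ ν : ℝ} {e c w : ℕ → ℝ} (hτ : 0 < τ) (hτy : τ ≤ y)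
    (hy : y < 1 / 4) (hσ : 0 ≤ σ) (hθ₁ : 1 - τ ^ 2 / 2 ≤ θ) (hθ₂ : σ + 4 * y ≤ θ)
    (he : ∀ k, e (k + 1) ≤ (1 - 31 / 32 * τ ^ 2) * e k + y * τ * c k + ν * θ ^ k)
    (hc : ∀ k, c (k + 1) ≤ σ * c k + y * τ * w k)
    (hw : ∀ k, w (k + 1) ≤ (σ + y * τ) * w k + (2 + y * τ) * c k + y * τ * e k + ν * θ ^ k) :
    ∃ M, ∀ k, e k ≤ M * (3 * y) * θ ^ k ∧ c k ≤ M * τ * θ ^ k ∧ w k ≤ M * θ ^ k := by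
  have hy0 : 0 < y := hτ.trans_le hτy
  have hθ0 : 0 ≤ θ := by linarith
  have hη : 0 < y * τ ^ 2 / 4 := by positivity
  obtain ⟨M, hM0, hMe, hMc, hMw, hMν⟩ : ∃ M : ℝ, 0 ≤ M ∧ e 0 ≤ M * (3 * y) ∧ c 0 ≤ M * τ ∧
      w 0 ≤ M ∧ ν ≤ M * (y * τ ^ 2 / 4) := by
    refine ⟨max 0 (max (e 0 / (3 * y)) (max (c 0 / τ) (max (w 0) (ν / (y * τ ^ 2 / 4))))),
      le_max_left _ _, ?_, ?_, ?_, ?_⟩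
    · rw [← div_le_iff₀ (by positivity)]; simp
    · rw [← div_le_iff₀ hτ]; simp
    · simp
    · rw [← div_le_iff₀ hη]; simp
  have hyτ : 0 ≤ y * τ := by positivity
  have hτ4 : τ < 1 / 4 := hτy.trans_lt hy
  -- the two sub-eigenvector inequalities that have to leave room for the perturbation
  have h1 : (1 - 31 / 32 * τ ^ 2) * (3 * y) + y * τ * τ + y * τ ^ 2 / 4 ≤ 3 * y * θ := by
    nlinarith [mul_le_mul_of_nonneg_left hθ₁ hy0.le, mul_pos hy0 (pow_pos hτ 2)]
  have h3 : (σ + y * τ) + (2 + y * τ) * τ + y * τ * (3 * y) + y * τ ^ 2 / 4 ≤ θ := by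
    have a1 : y * τ ≤ y * (1 / 4) := by gcongr
    have a2 : y * τ * τ ≤ y * (1 / 4) * (1 / 4) := by gcongr
    have a3 : y * τ * (3 * y) ≤ y * (1 / 4) * (3 * (1 / 4)) := by gcongr
    nlinarith
  have h2 : σ * τ + y * τ ≤ τ * θ := by
    nlinarith [mul_le_mul_of_nonneg_left hθ₂ hτ.le]
  refine ⟨M, fun k => ?_⟩
  induction k with
  | zero => simpa using ⟨hMe, hMc, hMw⟩
  | succ k ih =>
    obtain ⟨ie, ic, iw⟩ := ih
    have hθk : 0 ≤ θ ^ k := pow_nonneg hθ0 k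
    have hMk : 0 ≤ M * θ ^ k := mul_nonneg hM0 hθk
    have hν := mul_le_mul_of_nonneg_right hMν hθk
    have ha : 0 ≤ 1 - 31 / 32 * τ ^ 2 := by nlinarith
    refine ⟨(he k).trans ?_, (hc k).trans ?_, (hw k).trans ?_⟩
    · have b1 := mul_le_mul_of_nonneg_left ie ha
      have b2 := mul_le_mul_of_nonneg_left ic hyτ
      have b3 := mul_le_mul_of_nonneg_left h1 hMk
      rw [pow_succ θ k]
      linarith
    · have b1 := mul_le_mul_of_nonneg_left ic hσ
      have b2 := mul_le_mul_of_nonneg_left iw hyτ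
      have b3 := mul_le_mul_of_nonneg_left h2 hMk
      rw [pow_succ θ k]
      linarith
    · have b1 := mul_le_mul_of_nonneg_left iw (add_nonneg hσ hyτ)
      have b2 := mul_le_mul_of_nonneg_left ic (add_nonneg zero_le_two hyτ)
      have b4 := mul_le_mul_of_nonneg_left ie hyτ
      have b3 := mul_le_mul_of_nonneg_left h3 hMk
      rw [pow_succ θ k]
      linarith

/-- Orthogonal projections and their complements do not increase norms. -/
lemma norm_le_of_symmetric_idempotent {Y : Type*} [NormedAddCommGroup Y] [InnerProductSpace ℝ Y]
    {P : Y →ₗ[ℝ] Y} (hPsymm : P.IsSymmetric) (hPP : ∀ v, P (P v) = P v) (v : Y) :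
    ‖P v‖ ≤ ‖v‖ ∧ ‖v - P v‖ ≤ ‖v‖ := by
  have h : inner ℝ (P v) (v - P v) = 0 := by
    rw [hPsymm, map_sub, hPP, sub_self, inner_zero_right]
  have h2 := norm_add_sq_eq_norm_sq_add_norm_sq_real h
  rw [add_sub_cancel] at h2
  constructor <;> nlinarith [norm_nonneg (P v), norm_nonneg (v - P v), norm_nonneg v]

section Tracking

variable {X Y : Type*} [NormedAddCommGroup X] [InnerProductSpace ℝ X] [FiniteDimensional ℝ X]
  [NormedAddCommGroup Y] [InnerProductSpace ℝ Y] [FiniteDimensional ℝ Y] {F : X → ℝ}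

/-- The gradient of a strongly convex function is onto. -/
lemma exists_gradient_eq {m : ℝ} (hm : 0 < m) (hc : StrongConvexOn Set.univ m F)
    (hF : Differentiable ℝ F) (v : X) : ∃ x, gradient F x = v := by
  let H : X → ℝ := fun x => F x - inner ℝ v x
  have hcoer : Filter.Tendsto H (Filter.cocompact X) Filter.atTop := by
    have hq : Filter.Tendsto (fun r : ℝ => F 0 + r * (m / 2 * r - ‖gradient F 0 - v‖))
        Filter.atTop Filter.atTop := by
      apply Filter.tendsto_atTop_add_const_left
      apply Filter.Tendsto.atTop_mul_atTop₀ Filter.tendsto_id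
      apply Filter.tendsto_atTop_add_const_right
      exact Filter.tendsto_id.const_mul_atTop (by positivity)
    refine Filter.tendsto_atTop_mono (fun x => ?_) (hq.comp (tendsto_norm_cocompact_atTop (E := X)))
    have h1 := strongConvexOn_first_order hc hF 0 x
    have h2 := (abs_le.1 (abs_real_inner_le_norm (gradient F 0 - v) x)).1
    rw [inner_sub_left] at h2
    rw [sub_zero] at h1
    simp only [H, Function.comp]
    nlinarith
  obtain ⟨x, hx⟩ := (hF.continuous.sub (by fun_prop : Continuous fun x => inner ℝ v x)
    ).exists_forall_le hcoer
  refine ⟨x, ext_inner_right ℝ fun w => ?_⟩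
  have hd : HasDerivAt (fun t : ℝ => F (x + t • w) - inner ℝ v (x + t • w))
      (inner ℝ (gradient F x) w - inner ℝ v w) 0 := by
    have h1 := hasDerivAt_comp_line hF x w 0
    rw [zero_smul, add_zero] at h1
    refine h1.sub ?_
    simp only [inner_add_right, inner_smul_right]
    simpa using ((hasDerivAt_id (0 : ℝ)).mul_const (inner ℝ v w)).const_add (inner ℝ v x)
  have hmin : IsLocalMin (fun t : ℝ => F (x + t • w) - inner ℝ v (x + t • w)) 0 :=
    Filter.Eventually.of_forall fun t => by simpa using hx (x + t • w)
  exact sub_eq_zero.1 (hmin.hasDerivAt_eq_zero hd)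

/-- The inverse of the gradient of an `m`-strongly convex function is `1/m`-Lipschitz. -/
lemma mul_norm_sub_le_norm_gradient_sub {m : ℝ} (hc : StrongConvexOn Set.univ m F)
    (hF : Differentiable ℝ F) (x y : X) :
    m * ‖x - y‖ ≤ ‖gradient F x - gradient F y‖ := by
  have h1 := strongConvexOn_gradient_monotone hc hF x y
  have h2 := real_inner_le_norm (gradient F x - gradient F y) (x - y)
  rcases (norm_nonneg (x - y)).eq_or_lt with h0 | h0
  · rw [← h0, mul_zero]
    exact norm_nonneg _
  · exact le_of_mul_le_mul_right (by linarith) h0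

lemma norm_adjoint_le {B : X →ₗ[ℝ] Y} {S : ℝ} (hS : 0 ≤ S) (hB : ∀ w, ‖B w‖ ≤ S * ‖w‖) (v : Y) :
    ‖LinearMap.adjoint B v‖ ≤ S * ‖v‖ := by
  rcases (norm_nonneg (LinearMap.adjoint B v)).eq_or_lt with h0 | h0
  · rw [← h0]
    positivity
  · refine le_of_mul_le_mul_right ?_ h0
    rw [← sq, ← real_inner_self_eq_norm_sq, LinearMap.adjoint_inner_left]
    calc inner ℝ v (B (LinearMap.adjoint B v)) ≤ ‖v‖ * ‖B (LinearMap.adjoint B v)‖ :=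
          real_inner_le_norm _ _
      _ ≤ ‖v‖ * (S * ‖LinearMap.adjoint B v‖) := by gcongr; exact hB _
      _ = _ := by ring

variable {B : X →ₗ[ℝ] Y} {P W : Y →ₗ[ℝ] Y} {m L S t σ β : ℝ}

/-- One exact ascent step on the averaged dual function, measured against a dual optimum. The
deviation `v` of the averaged multiplier stays in the range of `P ∘ B`, where the dual function is
strongly concave with modulus `t² / L`; the dual gradient is `S² / m`-cocoercive because `F` is
strongly convex. -/
lemma dual_ascent_contraction (hPsymm : P.IsSymmetric) (hPP : ∀ v, P (P v) = P v)
    (hm : 0 < m) (hL : 0 < L) (ht : 0 ≤ t)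
    (hc : StrongConvexOn Set.univ m F) (hs : IsSmooth L F)
    (hB : ∀ w, ‖B w‖ ≤ S * ‖w‖)
    (hBt : ∀ w, t * ‖P (B w)‖ ≤ ‖LinearMap.adjoint B (P (B w))‖)
    (hβ : 0 < β) (hβS : β * (S ^ 2 / m) ≤ 1 / 16) (hβt : β * (t ^ 2 / L) ≤ 1)
    {v : Y} (hv : ∃ u, v = P (B u)) {x y : X}
    (hxy : gradient F x - gradient F y = -LinearMap.adjoint B v) :
    ‖v + β • P (B (x - y))‖ ≤ (1 - 31 / 32 * (β * (t ^ 2 / L))) * ‖v‖ := by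
  obtain ⟨u, rfl⟩ := hv
  set v := P (B u)
  set w := x - y
  set γ := inner ℝ (gradient F x - gradient F y) w with hγ
  have hinner : inner ℝ v (P (B w)) = -γ := by
    rw [← hPsymm, hPP, ← LinearMap.adjoint_inner_left, hγ, hxy, inner_neg_left, neg_neg]
  have h1 : m * ‖w‖ ^ 2 ≤ γ := strongConvexOn_gradient_monotone hc hs.1 x y
  have h2 : t ^ 2 * ‖v‖ ^ 2 ≤ L * γ := by
    have h := hs.gradient_cocoercive hL (hc.mono hm.le) x y
    refine le_trans ?_ h
    rw [hxy, norm_neg, ← mul_pow]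
    exact pow_le_pow_left₀ (by positivity) (hBt u) 2
  have h3 : ‖P (B w)‖ ^ 2 ≤ S ^ 2 / m * γ := by
    have hP := (norm_le_of_symmetric_idempotent hPsymm hPP (B w)).1
    calc ‖P (B w)‖ ^ 2 ≤ (S * ‖w‖) ^ 2 := pow_le_pow_left₀ (norm_nonneg _) (hP.trans (hB w)) 2
      _ = S ^ 2 / m * (m * ‖w‖ ^ 2) := by field_simp
      _ ≤ S ^ 2 / m * γ := by gcongr
  have hγ0 : 0 ≤ γ := le_trans (by positivity) h1
  have h4 : t ^ 2 / L * ‖v‖ ^ 2 ≤ γ := by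
    rw [div_mul_eq_mul_div, div_le_iff₀' hL]
    exact h2
  have hr : 0 ≤ 1 - 31 / 32 * (β * (t ^ 2 / L)) := by linarith
  refine le_of_sq_le_sq ?_ (mul_nonneg hr (norm_nonneg _))
  rw [norm_add_sq_real, inner_smul_right, hinner, norm_smul, mul_pow, Real.norm_eq_abs, sq_abs]
  have h5 : β ^ 2 * ‖P (B w)‖ ^ 2 ≤ β * (1 / 16) * γ := by
    calc β ^ 2 * ‖P (B w)‖ ^ 2 ≤ β ^ 2 * (S ^ 2 / m * γ) := by gcongr
      _ = β * (β * (S ^ 2 / m)) * γ := by ring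
      _ ≤ β * (1 / 16) * γ := by gcongr
  have h6 : β * (t ^ 2 / L * ‖v‖ ^ 2) ≤ β * γ := by gcongr
  nlinarith [sq_nonneg (31 / 32 * (β * (t ^ 2 / L)) * ‖v‖)]

end Tracking

section Convergence

variable {X Y : Type*} [NormedAddCommGroup X] [InnerProductSpace ℝ X] [FiniteDimensional ℝ X]
  [NormedAddCommGroup Y] [InnerProductSpace ℝ Y] [FiniteDimensional ℝ Y] {F : X → ℝ}

lemma norm_sub_le_of_gradient_sub_eq {B : X →ₗ[ℝ] Y} {m S : ℝ} (hm : 0 < m) (hS : 0 ≤ S)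
    (hc : StrongConvexOn Set.univ m F) (hF : Differentiable ℝ F) (hB : ∀ w, ‖B w‖ ≤ S * ‖w‖)
    {a b : X} {v : Y} (hab : gradient F a - gradient F b = -LinearMap.adjoint B v) :
    ‖a - b‖ ≤ S / m * ‖v‖ := by
  have h1 := mul_norm_sub_le_norm_gradient_sub hc hF a b
  rw [hab, norm_neg] at h1
  rw [div_mul_eq_mul_div, le_div_iff₀' hm]
  exact h1.trans (norm_adjoint_le hS hB v)

/-- Linear convergence of inexact dual gradient tracking, with the network abstracted to an
orthogonal projection `P` (averaging over the agents) and a mixing operator `W`, and with `B` the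
local constraint maps. -/
theorem tracking_isBigO {B : X →ₗ[ℝ] Y} {P W : Y →ₗ[ℝ] Y} {m L S t σ β θ D : ℝ}
    (hPsymm : P.IsSymmetric) (hPP : ∀ v, P (P v) = P v)
    (hWP : ∀ v, W (P v) = P v) (hPW : ∀ v, P (W v) = P v)
    (hW : ∀ v, ‖W v‖ ≤ ‖v‖) (hσ : 0 ≤ σ) (hWσ : ∀ v, ‖W v - P v‖ ≤ σ * ‖v‖)
    (hm : 0 < m) (hL : 0 < L) (hS : 0 < S) (ht : 0 < t)
    (hc : StrongConvexOn Set.univ m F) (hs : IsSmooth L F)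
    (hB : ∀ w, ‖B w‖ ≤ S * ‖w‖)
    (hBt : ∀ w, t * ‖P (B w)‖ ≤ ‖LinearMap.adjoint B (P (B w))‖)
    (hq : t ^ 2 / L ≤ S ^ 2 / m) (hβ : 0 < β)
    (hθ₁ : 1 - β * (t ^ 2 / L) / 2 ≤ θ)
    (hθ₂ : σ + 4 * √(β * ((S ^ 2 / m) ^ 2 / (t ^ 2 / L))) ≤ θ) (hθ : θ < 1)
    {xstar : X} (hstar : ∃ u, gradient F xstar = -LinearMap.adjoint B (P (B u)))
    {x h : ℕ → X} {Z Λ : ℕ → Y} (hD : 0 ≤ D)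
    (hh : ∀ k, gradient F (h k) = -LinearMap.adjoint B (Λ k))
    (hx : ∀ k, ‖x (k + 1) - h k‖ ≤ D * θ ^ k)
    (hZ0 : P (Z 0) = P (B (x 0 - xstar)))
    (hZ : ∀ k, Z (k + 1) = W (Z k) + B (x (k + 1) - x k))
    (hΛ0 : Λ 0 = 0) (hΛ : ∀ k, Λ (k + 1) = W (Λ k + β • Z (k + 1))) :
    (fun k => ‖x k - xstar‖) =O[Filter.atTop] (fun k : ℕ => θ ^ k) := by
  obtain ⟨ustar, hstar⟩ := hstar
  set Λs := P (B ustar) with hΛs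
  set K := S ^ 2 / m with hK
  set q := t ^ 2 / L with hq'
  have hK0 : 0 < K := by positivity
  have hq0 : 0 < q := by positivity
  -- chosen so that `y * τ = β * K`, the step size relative to the smoothness of the dual function
  set y := √(β * (K ^ 2 / q)) with hy
  set τ := √(β * q) with hτ
  have hτ0 : 0 < τ := Real.sqrt_pos.2 (by positivity)
  have hτ2 : τ ^ 2 = β * q := Real.sq_sqrt (by positivity)
  have hyτ : y * τ = β * K := by
    rw [hy, hτ, ← Real.sqrt_mul (by positivity)]
    rw [show β * (K ^ 2 / q) * (β * q) = (β * K) ^ 2 by field_simp]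
    exact Real.sqrt_sq (by positivity)
  have hτy : τ ≤ y := by
    apply Real.sqrt_le_sqrt
    gcongr
    rw [le_div_iff₀ hq0, ← sq]
    gcongr
  have hy4 : y < 1 / 4 := by linarith
  have hσ1 : σ ≤ 1 := by linarith [hτ0.trans_le hτy]
  have hθ0 : 0 < θ := by linarith [hτ0.trans_le hτy]
  have hPn : ∀ v, ‖P v‖ ≤ ‖v‖ := fun v => (norm_le_of_symmetric_idempotent hPsymm hPP v).1
  have hPn' : ∀ v, ‖v - P v‖ ≤ ‖v‖ := fun v => (norm_le_of_symmetric_idempotent hPsymm hPP v).2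
  have hlip : ∀ {a b : X} {v : Y}, gradient F a - gradient F b = -LinearMap.adjoint B v →
      ‖a - b‖ ≤ S / m * ‖v‖ :=
    fun hab => norm_sub_le_of_gradient_sub_eq hm hS.le hc hs.1 hB hab
  have hSm : S * (S / m) = K := by rw [hK]; ring
  -- gradient tracking: the average of `Z k` is the averaged constraint violation at `x k`
  have hPZ : ∀ k, P (Z k) = P (B (x k - xstar)) := by
    intro k
    induction k with
    | zero => exact hZ0
    | succ k ih =>
      rw [hZ, map_add, hPW, ih, ← map_add, ← map_add]
      congr 2
      abel
  have hPΛ : ∀ k, P (Λ (k + 1)) = P (Λ k) + β • P (B (x (k + 1) - xstar)) := by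
    intro k
    rw [hΛ, hPW, map_add, map_smul, hPZ]
  have hrange : ∀ k, ∃ u, P (Λ k) - Λs = P (B u) := by
    intro k
    induction k with
    | zero => exact ⟨-ustar, by rw [hΛ0, map_zero, map_neg, map_neg, zero_sub]⟩
    | succ k ih =>
      obtain ⟨u, hu⟩ := ih
      refine ⟨u + β • (x (k + 1) - xstar), ?_⟩
      rw [hPΛ, map_add, map_add, map_smul, map_smul, ← hu]
      abel
  -- `xb k` solves the inner problem for the averaged multiplier, `h k` for the actual ones
  choose xb hxb using fun k => exists_gradient_eq hm hc hs.1 (-LinearMap.adjoint B (P (Λ k)))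
  let E : ℕ → ℝ := fun k => ‖P (Λ k) - Λs‖
  let C : ℕ → ℝ := fun k => ‖Λ k - P (Λ k)‖
  let w : ℕ → ℝ := fun k => ‖Z (k + 1) - P (Z (k + 1))‖ / K
  have hwK : ∀ k, ‖Z (k + 1) - P (Z (k + 1))‖ = K * w k := fun k => by
    simp only [w]; field_simp
  have hθk : ∀ k, 0 ≤ θ ^ k := fun k => pow_nonneg hθ0.le k
  have hθs : ∀ k, D * θ ^ (k + 1) ≤ D * θ ^ k := fun k =>
    mul_le_mul_of_nonneg_left (pow_le_pow_of_le_one hθ0.le hθ.le (Nat.le_succ k)) hD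
  have hhxb : ∀ k, ‖h k - xb k‖ ≤ S / m * C k := fun k => hlip (by
    rw [hh, hxb, map_sub]; abel)
  have hhs : ∀ k, ‖h k - xstar‖ ≤ S / m * (C k + E k) := by
    intro k
    have h1 : ‖h k - xstar‖ ≤ S / m * ‖Λ k - Λs‖ := hlip (by rw [hh, hstar, map_sub]; abel)
    refine h1.trans ?_
    gcongr
    calc ‖Λ k - Λs‖ = ‖(Λ k - P (Λ k)) + (P (Λ k) - Λs)‖ := by congr 1; abel
      _ ≤ _ := norm_add_le _ _
  have hxs : ∀ k, ‖x (k + 1) - xstar‖ ≤ D * θ ^ k + S / m * (C k + E k) := by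
    intro k
    calc ‖x (k + 1) - xstar‖ = ‖(x (k + 1) - h k) + (h k - xstar)‖ := by congr 1; abel
      _ ≤ ‖x (k + 1) - h k‖ + ‖h k - xstar‖ := norm_add_le _ _
      _ ≤ _ := add_le_add (hx k) (hhs k)
  have hPB : ∀ v, ‖P (B v)‖ ≤ S * ‖v‖ := fun v => (hPn _).trans (hB v)
  have hE : ∀ k, E (k + 1) ≤ (1 - 31 / 32 * τ ^ 2) * E k + y * τ * C k + β * S * D * θ ^ k := by
    intro k
    have h1 : P (Λ (k + 1)) - Λs = (P (Λ k) - Λs + β • P (B (xb k - xstar)))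
        + β • P (B ((x (k + 1) - h k) + (h k - xb k))) := by
      rw [hPΛ]
      have : x (k + 1) - xstar = (xb k - xstar) + ((x (k + 1) - h k) + (h k - xb k)) := by abel
      rw [this, map_add, map_add, smul_add]
      abel
    have h2 : ‖P (Λ k) - Λs + β • P (B (xb k - xstar))‖ ≤ (1 - 31 / 32 * (β * q)) * E k := by
      refine dual_ascent_contraction hPsymm hPP hm hL ht.le hc hs hB hBt hβ ?_ ?_ (hrange k) ?_
      · rw [← hK, ← hyτ]
        nlinarith
      · rw [← hq', ← hτ2]
        nlinarith
      · rw [hxb, hstar, map_sub]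
        abel
    have h3 : ‖β • P (B ((x (k + 1) - h k) + (h k - xb k)))‖
        ≤ β * (S * (D * θ ^ k + S / m * C k)) := by
      rw [norm_smul, Real.norm_of_nonneg hβ.le]
      gcongr
      refine (hPB _).trans ?_
      gcongr
      exact (norm_add_le _ _).trans (add_le_add (hx k) (hhxb k))
    calc E (k + 1) ≤ (1 - 31 / 32 * (β * q)) * E k + β * (S * (D * θ ^ k + S / m * C k)) := by
          simp only [E]
          rw [h1]
          exact (norm_add_le _ _).trans (add_le_add h2 h3)
      _ = (1 - 31 / 32 * τ ^ 2) * E k + y * τ * C k + β * S * D * θ ^ k := by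
          rw [hτ2, hyτ, ← hSm]; ring
  have hdev : ∀ v, W v - P v = W (v - P v) - P (v - P v) := fun v => by
    rw [map_sub, map_sub, hWP, hPP]
    abel
  have hC : ∀ k, C (k + 1) ≤ σ * C k + y * τ * w k := by
    intro k
    have h1 : Λ (k + 1) - P (Λ (k + 1)) = W ((Λ k - P (Λ k)) + β • (Z (k + 1) - P (Z (k + 1))))
        - P ((Λ k - P (Λ k)) + β • (Z (k + 1) - P (Z (k + 1)))) := by
      rw [hΛ, hPW, hdev]
      congr 2 <;>
      · rw [map_add, map_smul, smul_sub]
        abel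
    have hw0 : 0 ≤ y * τ * w k := by
      rw [hyτ]
      positivity
    calc C (k + 1) ≤ σ * ‖(Λ k - P (Λ k)) + β • (Z (k + 1) - P (Z (k + 1)))‖ := by
          simp only [C]
          rw [h1]
          exact hWσ _
      _ ≤ σ * (C k + β * (K * w k)) := by
          gcongr
          refine (norm_add_le _ _).trans ?_
          rw [norm_smul, Real.norm_of_nonneg hβ.le, hwK]
      _ = σ * C k + σ * (y * τ * w k) := by rw [hyτ]; ring
      _ ≤ σ * C k + y * τ * w k := by
          have := mul_le_of_le_one_left hw0 hσ1
          linarith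
  have hstep : ∀ k, ‖Λ (k + 1) - Λ k‖ ≤
      (2 + y * τ) * C k + y * τ * w k + y * τ * E k + β * S * D * θ ^ k := by
    intro k
    have h1 : Λ (k + 1) - Λ k = (W (Λ k - P (Λ k)) - (Λ k - P (Λ k)))
        + β • W (Z (k + 1)) := by
      rw [hΛ, map_add, map_smul, map_sub, hWP]
      abel
    have h2 : ‖W (Λ k - P (Λ k)) - (Λ k - P (Λ k))‖ ≤ C k + C k :=
      (norm_sub_le _ _).trans (add_le_add (hW _) le_rfl)
    have h3 : ‖Z (k + 1)‖ ≤ K * w k + S * (D * θ ^ k + S / m * (C k + E k)) := by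
      calc ‖Z (k + 1)‖ = ‖(Z (k + 1) - P (Z (k + 1))) + P (Z (k + 1))‖ := by congr 1; abel
        _ ≤ K * w k + ‖P (Z (k + 1))‖ := by rw [← hwK]; exact norm_add_le _ _
        _ ≤ _ := by
          rw [hPZ]
          gcongr
          refine (hPB _).trans ?_
          gcongr
          exact hxs k
    calc ‖Λ (k + 1) - Λ k‖ ≤ (C k + C k)
          + β * (K * w k + S * (D * θ ^ k + S / m * (C k + E k))) := by
          rw [h1]
          refine (norm_add_le _ _).trans (add_le_add h2 ?_)
          rw [norm_smul, Real.norm_of_nonneg hβ.le]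
          gcongr
          exact (hW _).trans h3
      _ = _ := by rw [hyτ, ← hSm]; ring
  have hw : ∀ k, w (k + 1) ≤ (σ + y * τ) * w k + (2 + y * τ) * C k + y * τ * E k
      + (2 * S * D / K + β * S * D) * θ ^ k := by
    intro k
    have h1 : Z (k + 2) - P (Z (k + 2)) =
        (W (Z (k + 1) - P (Z (k + 1))) - P (Z (k + 1) - P (Z (k + 1))))
          + (B (x (k + 2) - x (k + 1)) - P (B (x (k + 2) - x (k + 1)))) := by
      rw [← hdev, hZ (k + 1), map_add, hPW]
      abel
    have h2 : ‖x (k + 2) - x (k + 1)‖ ≤ D * θ ^ k + D * θ ^ k + S / m * ‖Λ (k + 1) - Λ k‖ := by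
      have h3 : ‖h (k + 1) - h k‖ ≤ S / m * ‖Λ (k + 1) - Λ k‖ := hlip (by
        rw [hh, hh, map_sub]; abel)
      calc ‖x (k + 2) - x (k + 1)‖
          = ‖(x (k + 2) - h (k + 1)) - (x (k + 1) - h k) + (h (k + 1) - h k)‖ := by
            congr 1; abel
        _ ≤ ‖x (k + 2) - h (k + 1)‖ + ‖x (k + 1) - h k‖ + ‖h (k + 1) - h k‖ :=
            (norm_add_le _ _).trans (add_le_add (norm_sub_le _ _) le_rfl)
        _ ≤ _ := add_le_add (add_le_add ((hx (k + 1)).trans (hθs k)) (hx k)) h3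
    have h4 : K * w (k + 1) ≤ σ * (K * w k) + S * (D * θ ^ k + D * θ ^ k + S / m *
        ((2 + y * τ) * C k + y * τ * w k + y * τ * E k + β * S * D * θ ^ k)) := by
      rw [← hwK, h1, ← hwK]
      refine (norm_add_le _ _).trans (add_le_add (hWσ _) ((hPn' _).trans ((hB _).trans ?_)))
      gcongr
      refine h2.trans ?_
      gcongr
      exact hstep k
    refine le_of_mul_le_mul_left (h4.trans_eq ?_) hK0
    have h5 : K * (2 * S * D / K) = 2 * S * D := by field_simp
    linear_combination ((2 + y * τ) * C k + y * τ * w k + y * τ * E k + β * S * D * θ ^ k) * hSm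
      - θ ^ k * h5
  have hE' : ∀ k, E (k + 1) ≤ (1 - 31 / 32 * τ ^ 2) * E k + y * τ * C k
      + (2 * S * D / K + β * S * D) * θ ^ k := by
    intro k
    refine (hE k).trans ?_
    have : 0 ≤ 2 * S * D / K := by positivity
    gcongr
    linarith
  obtain ⟨M, hM⟩ := coupled_recursion_bound hτ0 hτy hy4 hσ (by rwa [hτ2]) hθ₂ hE' hC hw
  refine Asymptotics.IsBigO.of_bound ((D + S / m * (M * τ + M * (3 * y))) / θ) ?_
  filter_upwards [Filter.eventually_ge_atTop 1] with k hk
  obtain ⟨j, rfl⟩ := Nat.exists_eq_add_of_le' hk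
  obtain ⟨hEj, hCj, -⟩ := hM j
  rw [norm_norm, Real.norm_of_nonneg (hθk _)]
  calc ‖x (j + 1) - xstar‖ ≤ D * θ ^ j + S / m * (C j + E j) := hxs j
    _ ≤ D * θ ^ j + S / m * (M * τ * θ ^ j + M * (3 * y) * θ ^ j) := by gcongr
    _ = _ := by rw [pow_succ]; field_simp

end Convergence

/-! ### The network: mixing operators on stacked multipliers -/

section Mixing

/-- The stacked vector `(v_1, …, v_n)` of local multipliers or trackers, with the Euclidean norm
of `ℝ^{np}`. -/
abbrev Stack (n p : ℕ) : Type := PiLp 2 (fun _ : Fin n => EuclideanSpace ℝ (Fin p))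

variable {n p : ℕ}

/-- The operator `M ⊗ I_p`, which replaces block `i` by `∑ j, M i j • v_j`. -/
noncomputable def mix (M : Matrix (Fin n) (Fin n) ℝ) : Stack n p →ₗ[ℝ] Stack n p where
  toFun v := WithLp.toLp 2 fun i => ∑ j, M i j • v j
  map_add' v w := by
    ext i : 1
    simp [smul_add, Finset.sum_add_distrib]
  map_smul' a v := by
    ext i : 1
    simp [Finset.smul_sum, smul_comm a]

/-- The averaging matrix `(1/n) 1 1ᵀ`. -/
noncomputable def averaging (n : ℕ) : Matrix (Fin n) (Fin n) ℝ := Matrix.of fun _ _ => (1 / n : ℝ)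

lemma mix_apply (M : Matrix (Fin n) (Fin n) ℝ) (v : Stack n p) (i : Fin n) :
    mix M v i = ∑ j, M i j • v j := rfl

lemma mix_mul (M N : Matrix (Fin n) (Fin n) ℝ) (v : Stack n p) :
    mix (M * N) v = mix M (mix N v) := by
  ext i : 1
  simp only [mix_apply, Matrix.mul_apply, Finset.sum_smul, Finset.smul_sum, smul_smul]
  exact Finset.sum_comm

lemma mix_sub (M N : Matrix (Fin n) (Fin n) ℝ) (v : Stack n p) :
    mix (M - N) v = mix M v - mix N v := by
  ext i : 1
  simp [mix_apply, sub_smul]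

lemma mix_isSymmetric {M : Matrix (Fin n) (Fin n) ℝ} (hM : M.IsSymm) :
    (mix (p := p) M).IsSymmetric := by
  intro v w
  simp only [PiLp.inner_apply (𝕜 := ℝ) (f := fun _ : Fin n => EuclideanSpace ℝ (Fin p)), mix_apply,
    sum_inner, inner_sum, real_inner_smul_left, real_inner_smul_right]
  rw [Finset.sum_comm]
  simp only [hM.apply]

lemma norm_mix_le (M : Matrix (Fin n) (Fin n) ℝ) (v : Stack n p) :
    ‖mix M v‖ ≤ ‖Matrix.toEuclideanCLM (n := Fin n) (𝕜 := ℝ) M‖ * ‖v‖ := by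
  refine le_of_sq_le_sq ?_ (by positivity)
  -- the operator acts on each of the `p` coordinates separately, as `M` does
  let col : Fin p → EuclideanSpace ℝ (Fin n) := fun c => WithLp.toLp 2 fun j => v j c
  have h1 : ‖v‖ ^ 2 = ∑ c, ‖col c‖ ^ 2 := by
    simp only [PiLp.norm_sq_eq_of_L2, col]
    exact Finset.sum_comm
  have h2 : ‖mix M v‖ ^ 2 = ∑ c, ‖Matrix.toEuclideanCLM (n := Fin n) (𝕜 := ℝ) M (col c)‖ ^ 2 := by
    simp only [PiLp.norm_sq_eq_of_L2, col]
    rw [Finset.sum_comm]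
    refine Finset.sum_congr rfl fun c _ => Finset.sum_congr rfl fun i _ => ?_
    simp [mix_apply, Matrix.mulVec, dotProduct]
  rw [mul_pow, h1, h2, Finset.mul_sum]
  refine Finset.sum_le_sum fun c _ => ?_
  rw [← mul_pow]
  gcongr
  exact ContinuousLinearMap.le_opNorm _ _

/-- By Jensen's inequality, a doubly stochastic matrix does not increase the Euclidean norm. -/
lemma norm_toEuclideanCLM_le_one {M : Matrix (Fin n) (Fin n) ℝ}
    (hM : M ∈ doublyStochastic ℝ (Fin n)) :
    ‖Matrix.toEuclideanCLM (n := Fin n) (𝕜 := ℝ) M‖ ≤ 1 := by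
  refine ContinuousLinearMap.opNorm_le_bound _ zero_le_one fun v => ?_
  rw [one_mul]
  refine le_of_sq_le_sq ?_ (norm_nonneg v)
  rw [EuclideanSpace.real_norm_sq_eq, EuclideanSpace.real_norm_sq_eq]
  calc ∑ i, (Matrix.toEuclideanCLM (n := Fin n) (𝕜 := ℝ) M v) i ^ 2
      ≤ ∑ i, ∑ j, M i j * v j ^ 2 := by
        refine Finset.sum_le_sum fun i _ => ?_
        have h := (even_two.convexOn_pow (𝕜 := ℝ)).map_sum_le (t := Finset.univ)
          (w := fun j => M i j) (p := fun j => v j)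
          (fun j _ => nonneg_of_mem_doublyStochastic hM) (sum_row_of_mem_doublyStochastic hM i)
          (fun j _ => Set.mem_univ _)
        simpa [Matrix.mulVec, dotProduct] using h
    _ = ∑ j, v j ^ 2 := by
        rw [Finset.sum_comm]
        simp [← Finset.sum_mul, sum_col_of_mem_doublyStochastic hM]

lemma averaging_mem_doublyStochastic [NeZero n] : averaging n ∈ doublyStochastic ℝ (Fin n) := by
  rw [mem_doublyStochastic_iff_sum]
  have : (n : ℝ) ≠ 0 := NeZero.ne _
  refine ⟨fun i j => ?_, fun i => ?_, fun j => ?_⟩ <;> simp [averaging, this]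

lemma averaging_isSymm : (averaging n).IsSymm := rfl

lemma mul_averaging {M : Matrix (Fin n) (Fin n) ℝ} (hM : M ∈ doublyStochastic ℝ (Fin n)) :
    M * averaging n = averaging n := by
  ext i j
  simp [averaging, Matrix.mul_apply, ← Finset.sum_mul, sum_row_of_mem_doublyStochastic hM]

lemma averaging_mul {M : Matrix (Fin n) (Fin n) ℝ} (hM : M ∈ doublyStochastic ℝ (Fin n)) :
    averaging n * M = averaging n := by
  ext i j
  simp [averaging, Matrix.mul_apply, ← Finset.mul_sum, sum_col_of_mem_doublyStochastic hM]

lemma mix_averaging_toLp_const [NeZero n] (a : EuclideanSpace ℝ (Fin p)) (i : Fin n) :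
    mix (averaging n) (WithLp.toLp 2 fun _ => a : Stack n p) i = a := by
  rw [mix_apply]
  simp only [← Finset.sum_smul, averaging, Matrix.of_apply]
  simp

lemma mixingNorm_le_one [NeZero n] {M : Matrix (Fin n) (Fin n) ℝ}
    (hM : M ∈ doublyStochastic ℝ (Fin n)) : mixingNorm M ≤ 1 := by
  have hJ := averaging_mem_doublyStochastic (n := n)
  -- `M - J = M (1 - J)`, a product of two contractions
  have hstar : IsStarProjection (averaging n) :=
    ⟨mul_averaging hJ, by ext; simp [averaging]⟩
  have hproj := (hstar.map (Matrix.toEuclideanCLM (n := Fin n) (𝕜 := ℝ))).one_sub.norm_le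
  have h : M - averaging n = M * (1 - averaging n) := by rw [mul_sub, mul_one, mul_averaging hM]
  change ‖Matrix.toEuclideanCLM (n := Fin n) (𝕜 := ℝ) (M - averaging n)‖ ≤ 1
  rw [h, map_mul, map_sub, map_one]
  exact (norm_mul_le _ _).trans
    (mul_le_one₀ (norm_toEuclideanCLM_le_one hM) (norm_nonneg _) hproj)

end Mixing

/-! ### The aggregate objective and the constraint maps -/

section Blocks

variable {n p : ℕ} {d : Fin n → ℕ}

/-- The block diagonal constraint map `(x_1, …, x_n) ↦ (A_1 x_1, …, A_n x_n)`. -/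
noncomputable def blockMap (A : ∀ i, Matrix (Fin p) (Fin (d i)) ℝ) :
    Decision d →ₗ[ℝ] Stack n p where
  toFun x := WithLp.toLp 2 fun i => Matrix.toEuclideanLin (A i) (x i)
  map_add' v w := by
    ext i : 1
    simp
  map_smul' a v := by
    ext i : 1
    simp

lemma blockMap_apply (A : ∀ i, Matrix (Fin p) (Fin (d i)) ℝ) (x : Decision d) (i : Fin n) :
    blockMap A x i = Matrix.toEuclideanLin (A i) (x i) := rfl

lemma norm_blockMap_le (A : ∀ i, Matrix (Fin p) (Fin (d i)) ℝ) (x : Decision d) :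
    ‖blockMap A x‖ ≤ sigmaMax (Matrix.blockDiagonal' A) * ‖x‖ := by
  let ι := LinearIsometryEquiv.piLpCurry ℝ 2 (fun (i : Fin n) (_ : Fin (d i)) => ℝ)
  let κ := LinearIsometryEquiv.piLpCurry ℝ 2 (fun (_ : Fin n) (_ : Fin p) => ℝ)
  have h : blockMap A x = κ (Matrix.toEuclideanLin (Matrix.blockDiagonal' A) (ι.symm x)) := by
    ext i c
    simp [κ, ι, blockMap_apply, Matrix.mulVec, dotProduct, Sigma.curry, Fintype.sum_sigma,
      Matrix.blockDiagonal'_apply]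
    rfl
  rw [h, κ.norm_map, ← ι.symm.norm_map x]
  exact norm_toEuclideanLin_le_sigmaMax _ _

lemma mix_averaging_blockMap (A : ∀ i, Matrix (Fin p) (Fin (d i)) ℝ) (x : Decision d) (i : Fin n) :
    mix (averaging n) (blockMap A x) i =
      (1 / n : ℝ) • ∑ j, Matrix.toEuclideanLin (A j) (x j) := by
  simp [mix_apply, averaging, blockMap_apply, Finset.smul_sum]

lemma toEuclideanLin_stacked (A : ∀ i, Matrix (Fin p) (Fin (d i)) ℝ) (x : Decision d) :
    Matrix.toEuclideanLin (stacked A)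
        ((LinearIsometryEquiv.piLpCurry ℝ 2 (fun (i : Fin n) (_ : Fin (d i)) => ℝ)).symm x) =
      ∑ i, Matrix.toEuclideanLin (A i) (x i) := by
  ext c
  simp [Matrix.mulVec, dotProduct, stacked, Fintype.sum_sigma]
  rfl

/-- The bound `sigmaMin_mul_norm_le` for `A = [A_1, …, A_n]`, transported to averaged stacks; the
averaged stack `P B x` has all blocks equal to `(1/n) A x`, hence the norm `‖A x‖ / √n`. -/
lemma sigmaMin_mul_norm_averaging_le [NeZero n] (A : ∀ i, Matrix (Fin p) (Fin (d i)) ℝ)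
    (x : Decision d) :
    sigmaMin (stacked A) / √n * ‖mix (averaging n) (blockMap A x)‖ ≤
      ‖LinearMap.adjoint (blockMap A) (mix (averaging n) (blockMap A x))‖ := by
  let ι := LinearIsometryEquiv.piLpCurry ℝ 2 (fun (i : Fin n) (_ : Fin (d i)) => ℝ)
  let T := Matrix.toEuclideanLin (stacked A)
  set a := T (ι.symm x) with ha
  have hn : (0 : ℝ) < n := Nat.cast_pos.2 (NeZero.pos n)
  have hblock : ∀ i, mix (averaging n) (blockMap A x) i = (1 / n : ℝ) • a := fun i => by
    rw [mix_averaging_blockMap, ha, toEuclideanLin_stacked]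
  have hadj : LinearMap.adjoint (blockMap A) (mix (averaging n) (blockMap A x)) =
      (1 / n : ℝ) • ι (LinearMap.adjoint T a) := by
    refine ext_inner_right ℝ fun w => ?_
    rw [LinearMap.adjoint_inner_left, real_inner_smul_left, ← ι.symm.inner_map_map,
      ι.symm_apply_apply, LinearMap.adjoint_inner_left, toEuclideanLin_stacked, inner_sum,
      PiLp.inner_apply, Finset.mul_sum]
    refine Finset.sum_congr rfl fun i _ => ?_
    rw [hblock, real_inner_smul_left, blockMap_apply]
  have hnorm : ‖mix (averaging n) (blockMap A x)‖ = √n * ((1 / n) * ‖a‖) := by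
    rw [PiLp.norm_eq_of_L2]
    simp only [hblock, norm_smul, Finset.sum_const, Finset.card_univ, Fintype.card_fin,
      nsmul_eq_mul]
    rw [Real.sqrt_mul hn.le, Real.sqrt_sq (by positivity), Real.norm_of_nonneg (by positivity)]
  rw [hnorm, hadj, norm_smul, ι.norm_map, Real.norm_of_nonneg (by positivity)]
  have h := sigmaMin_mul_norm_le (stacked A) (ι.symm x)
  have hs : 0 < √(n : ℝ) := Real.sqrt_pos.2 hn
  calc sigmaMin (stacked A) / √n * (√n * ((1 / n) * ‖a‖))
      = (1 / n) * (sigmaMin (stacked A) * ‖a‖) := by field_simp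
    _ ≤ _ := by gcongr

variable {f : ∀ i, EuclideanSpace ℝ (Fin (d i)) → ℝ}

lemma hasGradientAt_totalCost (hf : ∀ i, Differentiable ℝ (f i)) (x : Decision d) :
    HasGradientAt (totalCost f) (WithLp.toLp 2 fun i => gradient (f i) (x i)) x := by
  rw [hasGradientAt_iff_hasFDerivAt]
  have h : HasFDerivAt (totalCost f) (∑ i, (fderiv ℝ (f i) (x i)).comp
      (PiLp.proj 2 (fun i => EuclideanSpace ℝ (Fin (d i))) i)) x :=
    HasFDerivAt.fun_sum fun i _ =>
      ((hf i (x i)).hasFDerivAt.comp x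
        (PiLp.proj (𝕜 := ℝ) 2 (fun i => EuclideanSpace ℝ (Fin (d i))) i).hasFDerivAt)
  convert! h using 1
  ext w
  simp [PiLp.inner_apply, inner_gradient_left]

lemma totalCost_isSmooth {l : Fin n → ℝ} {L : ℝ} (hL : 0 ≤ L) (hlL : ∀ i, l i ≤ L)
    (hf : ∀ i, IsSmooth (l i) (f i)) : IsSmooth L (totalCost f) := by
  have hg := fun x => hasGradientAt_totalCost (fun i => (hf i).1) x
  refine ⟨fun x => (hg x).differentiableAt, fun x y => ?_⟩
  rw [(hg x).gradient, (hg y).gradient]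
  refine le_of_sq_le_sq ?_ (by positivity)
  rw [mul_pow, PiLp.norm_sq_eq_of_L2, PiLp.norm_sq_eq_of_L2, Finset.mul_sum]
  refine Finset.sum_le_sum fun i _ => ?_
  rw [← mul_pow]
  refine pow_le_pow_left₀ (norm_nonneg _) (((hf i).2 (x i) (y i)).trans ?_) 2
  exact mul_le_mul_of_nonneg_right (hlL i) (norm_nonneg _)

lemma totalCost_strongConvexOn {μ : Fin n → ℝ} {m : ℝ} (hm : ∀ i, m ≤ μ i)
    (hf : ∀ i, StrongConvexOn Set.univ (μ i) (f i)) :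
    StrongConvexOn Set.univ m (totalCost f) := by
  refine ⟨convex_univ, fun x _ y _ a b ha hb hab => ?_⟩
  simp only [totalCost, smul_eq_mul]
  rw [PiLp.norm_sq_eq_of_L2]
  simp only [Finset.mul_sum, ← Finset.sum_add_distrib, ← Finset.sum_sub_distrib]
  exact Finset.sum_le_sum fun i _ =>
    ((hf i).mono (hm i)).2 (Set.mem_univ (x i)) (Set.mem_univ (y i)) ha hb hab

/-- First order optimality for the inner problem: the gradient equals `-𝐀ᵀ λ`. -/
lemma gradient_eq_of_lagrangian_min {A : ∀ i, Matrix (Fin p) (Fin (d i)) ℝ}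
    {b : EuclideanSpace ℝ (Fin p)} (hF : Differentiable ℝ (totalCost f))
    {lam : Fin n → EuclideanSpace ℝ (Fin p)} {xs : Decision d}
    (hxs : ∀ y, lagrangian f A b lam xs ≤ lagrangian f A b lam y) :
    gradient (totalCost f) xs = -LinearMap.adjoint (blockMap A) (WithLp.toLp 2 lam) := by
  have hlag : ∀ x, lagrangian f A b lam x = totalCost f x
      + inner ℝ (WithLp.toLp 2 lam : Stack n p) (blockMap A x)
      - ∑ i, inner ℝ (lam i) ((1 / n : ℝ) • b) := by
    intro x
    simp only [lagrangian, totalCost, PiLp.inner_apply, blockMap_apply, inner_sub_right,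
      Finset.sum_add_distrib, Finset.sum_sub_distrib]
    ring
  refine ext_inner_right ℝ fun w => ?_
  rw [inner_neg_left, LinearMap.adjoint_inner_left, ← add_eq_zero_iff_eq_neg]
  have h1 := hasDerivAt_comp_line hF xs w 0
  rw [zero_smul, add_zero] at h1
  have hd : HasDerivAt (fun t : ℝ => lagrangian f A b lam (xs + t • w))
      (inner ℝ (gradient (totalCost f) xs) w
        + inner ℝ (WithLp.toLp 2 lam : Stack n p) (blockMap A w)) 0 := by
    simp only [hlag]
    refine (h1.add ?_).sub_const _
    simp only [map_add, map_smul, inner_add_right, real_inner_smul_right]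
    simpa using ((hasDerivAt_id (0 : ℝ)).mul_const
      (inner ℝ (WithLp.toLp 2 lam : Stack n p) (blockMap A w))).const_add
      (inner ℝ (WithLp.toLp 2 lam : Stack n p) (blockMap A xs))
  have hmin : IsLocalMin (fun t : ℝ => lagrangian f A b lam (xs + t • w)) 0 :=
    Filter.Eventually.of_forall fun t => by simpa using hxs (xs + t • w)
  exact hmin.hasDerivAt_eq_zero hd

/-- The Karush–Kuhn–Tucker conditions for the coupled problem, with a multiplier that is the same
for all agents and lies in the range of `A`. -/
lemma IsSolution.exists_multiplier [NeZero n] {A : ∀ i, Matrix (Fin p) (Fin (d i)) ℝ}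
    {b : EuclideanSpace ℝ (Fin p)} (hF : Differentiable ℝ (totalCost f)) {x : Decision d}
    (hx : IsSolution f A b x) :
    ∃ u, gradient (totalCost f) x =
      -LinearMap.adjoint (blockMap A) (mix (averaging n) (blockMap A u)) := by
  have hn : (n : ℝ) ≠ 0 := NeZero.ne _
  let P : Stack n p →ₗ[ℝ] Stack n p := mix (averaging n)
  have hP : P.IsSymmetric := mix_isSymmetric averaging_isSymm
  let Q := P ∘ₗ blockMap A
  have hmem : gradient (totalCost f) x ∈ Q.kerᗮ := by
    rw [Submodule.mem_orthogonal']
    intro w hw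
    have hw0 : ∑ i, Matrix.toEuclideanLin (A i) (w i) = 0 := by
      have h := congrArg (fun v : Stack n p => v 0) (LinearMap.mem_ker.1 hw)
      simp only [Q, P, LinearMap.comp_apply, mix_averaging_blockMap] at h
      exact (smul_eq_zero.1 h).resolve_left (by simpa using hn)
    have h1 := hasDerivAt_comp_line hF x w 0
    rw [zero_smul, add_zero] at h1
    have hmin : IsLocalMin (fun t : ℝ => totalCost f (x + t • w)) 0 := by
      refine Filter.Eventually.of_forall fun t => ?_
      have := hx.2 (x + t • w) (by
        simp only [PiLp.add_apply, PiLp.smul_apply, map_add, map_smul, Finset.sum_add_distrib,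
          ← Finset.smul_sum, hw0, smul_zero, add_zero, hx.1])
      simpa using this
    exact hmin.hasDerivAt_eq_zero h1
  rw [LinearMap.orthogonal_ker, ← LinearMap.range_adjoint_comp_self] at hmem
  obtain ⟨u, hu⟩ := hmem
  refine ⟨-u, ?_⟩
  rw [← hu, map_neg, map_neg, map_neg, neg_neg]
  refine ext_inner_right ℝ fun w => ?_
  rw [LinearMap.comp_apply, LinearMap.adjoint_inner_left, LinearMap.adjoint_inner_left]
  simp only [Q, LinearMap.comp_apply]
  rw [← hP, ← mix_mul, mul_averaging averaging_mem_doublyStochastic]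

end Blocks

lemma StrongConvexOn.le_of_isSmooth {E : Type*} [NormedAddCommGroup E] [InnerProductSpace ℝ E]
    [CompleteSpace E] [Nontrivial E] {g : E → ℝ} {m L : ℝ} (hc : StrongConvexOn Set.univ m g)
    (hs : IsSmooth L g) : m ≤ L := by
  obtain ⟨x, hx⟩ := exists_ne (0 : E)
  have hpos : 0 < ‖x - 0‖ ^ 2 := by
    rw [sub_zero]
    positivity
  refine le_of_mul_le_mul_right ?_ hpos
  have h1 := strongConvexOn_gradient_monotone hc hs.1 x 0
  have h2 := real_inner_le_norm (gradient g x - gradient g 0) (x - 0)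
  have h3 := mul_le_mul_of_nonneg_right (hs.2 x 0) (norm_nonneg (x - 0))
  linarith

lemma exists_averaging_blockMap_ne_zero {n p : ℕ} [NeZero n] {d : Fin n → ℕ}
    {A : ∀ i, Matrix (Fin p) (Fin (d i)) ℝ} (hA : stacked A ≠ 0) :
    ∃ w, mix (averaging n) (blockMap A w) ≠ 0 := by
  by_contra! h
  refine hA ((map_eq_zero_iff _ (Matrix.toEuclideanLin (𝕜 := ℝ)).injective).1 ?_)
  refine LinearMap.ext fun x => ?_
  let ι := LinearIsometryEquiv.piLpCurry ℝ 2 (fun (i : Fin n) (_ : Fin (d i)) => ℝ)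
  have h1 := congrArg (fun v : Stack n p => v 0) (h (ι x))
  have hn : (1 / n : ℝ) ≠ 0 := one_div_ne_zero (NeZero.ne _)
  simp only [mix_averaging_blockMap] at h1
  have h2 := (smul_eq_zero.1 h1).resolve_left hn
  rw [← toEuclideanLin_stacked] at h2
  simpa [ι] using h2

end IDDGT

/-! ### Convergence of the method -/

theorem mainTheorem1 {n p : ℕ} {d : Fin n → ℕ}
    (f : ∀ i, EuclideanSpace ℝ (Fin (d i)) → ℝ)
    (A : ∀ i, Matrix (Fin p) (Fin (d i)) ℝ) (b : EuclideanSpace ℝ (Fin p))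
    (hA : IDDGT.stacked A ≠ 0)
    (μ l : Fin n → ℝ) (hμ : ∀ i, 0 < μ i) (hl : ∀ i, 0 < l i)
    (hconv : ∀ i, StrongConvexOn Set.univ (μ i) (f i))
    (hsmooth : ∀ i, IDDGT.IsSmooth (l i) (f i))
    (xstar : IDDGT.Decision d) (hxstar : IDDGT.IsSolution f A b xstar)
    (W : Matrix (Fin n) (Fin n) ℝ) (hWprim : W.IsPrimitive)
    (hWds : W ∈ doublyStochastic ℝ (Fin n)) (hWdiag : ∀ i, 0 < W i i)
    (m L σ : ℝ) (hm : m = ⨅ i, μ i) (hL : L = ⨆ i, l i) (hσ : σ = IDDGT.mixingNorm W)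
    (β : ℝ) (hβ_pos : 0 < β)
    (hβ : β < min (m / IDDGT.sigmaMax (Matrix.blockDiagonal' A) ^ 2)
      ((1 - σ) ^ 2 * IDDGT.sigmaMin (IDDGT.stacked A) ^ 2 * m ^ 2 /
        (16 * IDDGT.sigmaMax (Matrix.blockDiagonal' A) ^ 4 * n * L)))
    (γ : ℝ) (hγ : γ ∈ Set.Ioo (0 : ℝ) 1)
    (δ : ℕ → ℝ) (hδ : ∀ k, δ (k + 1) = γ * δ k)
    (x : ℕ → IDDGT.Decision d) (z lam : ℕ → Fin n → EuclideanSpace ℝ (Fin p))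
    (hrun : IDDGT.IsRun f A b W β δ x z lam)
    (θ : ℝ)
    (hθ : θ = max (max (1 - β * IDDGT.sigmaMin (IDDGT.stacked A) ^ 2 / (2 * n * L))
      (σ + 4 * √(β * (IDDGT.sigmaMax (Matrix.blockDiagonal' A) ^ 4 * n * L /
        (IDDGT.sigmaMin (IDDGT.stacked A) ^ 2 * m ^ 2))))) γ) :
    θ ∈ Set.Ioo (0 : ℝ) 1 ∧
      (fun k => ‖x k - xstar‖) =O[Filter.atTop] (fun k : ℕ => θ ^ k) := by
  have hn0 : n ≠ 0 := by
    rintro rfl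
    exact hA (by ext r c; exact c.1.elim0)
  have : NeZero n := ⟨hn0⟩
  have hn : (0 : ℝ) < n := Nat.cast_pos.2 (NeZero.pos n)
  set S := IDDGT.sigmaMax (Matrix.blockDiagonal' A)
  set s := IDDGT.sigmaMin (IDDGT.stacked A)
  have hmle : ∀ i, m ≤ μ i := fun i => hm ▸ ciInf_le (Set.finite_range μ).bddBelow i
  have hlle : ∀ i, l i ≤ L := fun i => hL ▸ le_ciSup (Set.finite_range l).bddAbove i
  have hm0 : 0 < m := by
    obtain ⟨i, hi⟩ := exists_eq_ciInf_of_finite (f := μ)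
    rw [hm, ← hi]
    exact hμ i
  have hL0 : 0 < L := (hl 0).trans_le (hlle 0)
  -- A vanishing singular value, or `σ = 1`, would make an upper bound for `β` equal to zero.
  have hβ1 := hβ_pos.trans (hβ.trans_le (min_le_left _ _))
  have hβ2 := hβ.trans_le (min_le_right _ _)
  have hpos := hβ_pos.trans hβ2
  have hS : 0 < S := (IDDGT.sigmaMax_nonneg _).lt_of_ne' fun (h : S = 0) => by simp [h] at hβ1
  have hs : 0 < s := (IDDGT.sigmaMin_nonneg _).lt_of_ne' fun (h : s = 0) => by simp [h] at hpos
  have hσ0 : 0 ≤ σ := hσ ▸ norm_nonneg _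
  have hσ1 : σ < 1 := (hσ ▸ IDDGT.mixingNorm_le_one hWds : σ ≤ 1).lt_of_ne fun h => by
    simp [h] at hpos
  have hsqrt : √(β * (S ^ 4 * n * L / (s ^ 2 * m ^ 2))) < (1 - σ) / 4 := by
    rw [Real.sqrt_lt' (by linarith)]
    calc β * (S ^ 4 * n * L / (s ^ 2 * m ^ 2))
        < (1 - σ) ^ 2 * s ^ 2 * m ^ 2 / (16 * S ^ 4 * n * L) *
            (S ^ 4 * n * L / (s ^ 2 * m ^ 2)) := by
          gcongr
      _ = ((1 - σ) / 4) ^ 2 := by field_simp; norm_num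
  have hθ1 : θ < 1 := by
    rw [hθ, max_lt_iff, max_lt_iff]
    refine ⟨⟨sub_lt_self _ (by positivity), by linarith⟩, hγ.2⟩
  have hγθ : γ ≤ θ := hθ ▸ le_max_right _ _
  have hθ0 : 0 < θ := hγ.1.trans_le hγθ
  refine ⟨⟨hθ0, hθ1⟩, ?_⟩
  have hJ := IDDGT.averaging_mem_doublyStochastic (n := n)
  have hc : StrongConvexOn Set.univ m (IDDGT.totalCost f) :=
    IDDGT.totalCost_strongConvexOn hmle hconv
  have hsm : IDDGT.IsSmooth L (IDDGT.totalCost f) :=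
    IDDGT.totalCost_isSmooth hL0.le hlle hsmooth
  have hB := IDDGT.norm_blockMap_le A
  have hBt := IDDGT.sigmaMin_mul_norm_averaging_le A
  -- the condition number of the dual problem is at least one
  have hq : (s / √n) ^ 2 / L ≤ S ^ 2 / m := by
    obtain ⟨w, hw⟩ := IDDGT.exists_averaging_blockMap_ne_zero hA
    have hw0 : w ≠ 0 := fun h => hw (by rw [h, map_zero, map_zero])
    have : Nontrivial (IDDGT.Decision d) := ⟨w, 0, hw0⟩
    have h1 : s / √n ≤ S := le_of_mul_le_mul_right
      ((hBt w).trans (IDDGT.norm_adjoint_le hS.le hB _)) (norm_pos_iff.2 hw)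
    have h2 : m ≤ L := IDDGT.StrongConvexOn.le_of_isSmooth hc hsm
    gcongr
  have ht2 : (s / √n) ^ 2 = s ^ 2 / n := by rw [div_pow, Real.sq_sqrt hn.le]
  have hδpow : ∀ k, δ k = γ ^ k * δ 0 := by
    intro k
    induction k with
    | zero => simp
    | succ k ih => rw [hδ, ih, pow_succ]; ring
  choose h hmin hxh using hrun.x_succ
  refine IDDGT.tracking_isBigO (B := IDDGT.blockMap A) (P := IDDGT.mix (IDDGT.averaging n))
    (W := IDDGT.mix W) (S := S) (t := s / √n) (h := h) (D := |δ 0|)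
    (Z := fun k => WithLp.toLp 2 (z k)) (Λ := fun k => WithLp.toLp 2 (lam k))
    (IDDGT.mix_isSymmetric IDDGT.averaging_isSymm)
    (fun v => by rw [← IDDGT.mix_mul, IDDGT.mul_averaging hJ])
    (fun v => by rw [← IDDGT.mix_mul, IDDGT.mul_averaging hWds])
    (fun v => by rw [← IDDGT.mix_mul, IDDGT.averaging_mul hWds])
    (fun v => (IDDGT.norm_mix_le W v).trans
      (mul_le_of_le_one_left (norm_nonneg v) (IDDGT.norm_toEuclideanCLM_le_one hWds)))
    hσ0 (fun v => ?_) hm0 hL0 hS (by positivity) hc hsm hB hBt hq hβ_pos ?_ ?_ hθ1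
    (hxstar.exists_multiplier hsm.1) (abs_nonneg _)
    (fun k => IDDGT.gradient_eq_of_lagrangian_min hsm.1 (hmin k)) (fun k => ?_) ?_ (fun k => ?_)
    ?_ (fun k => ?_)
  · rw [← IDDGT.mix_sub, hσ]
    exact IDDGT.norm_mix_le _ v
  · rw [ht2]
    refine le_trans (le_of_eq ?_) (hθ ▸ (le_max_left _ _).trans (le_max_left _ _))
    field_simp
  · rw [ht2]
    refine le_trans (le_of_eq ?_) (hθ ▸ (le_max_right _ _).trans (le_max_left _ _))
    congr 4
    field_simp
  · refine (hxh k).trans ?_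
    rw [hδpow, mul_comm]
    have h1 : γ ^ (k + 1) ≤ θ ^ k := (pow_le_pow_of_le_one hγ.1.le hγ.2.le k.le_succ).trans
      (pow_le_pow_left₀ hγ.1.le hγθ k)
    exact mul_le_mul (le_abs_self _) h1 (pow_nonneg hγ.1.le _) (abs_nonneg _)
  · have hz : (WithLp.toLp 2 (z 0) : IDDGT.Stack n p) =
        IDDGT.blockMap A (x 0) - WithLp.toLp 2 fun _ => (1 / n : ℝ) • b := by
      ext i : 1
      exact hrun.z_zero i
    rw [hz, map_sub, map_sub, map_sub]
    congr 1
    ext i : 1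
    rw [IDDGT.mix_averaging_blockMap, hxstar.1, IDDGT.mix_averaging_toLp_const]
  · ext i : 1
    exact hrun.z_succ k i
  · ext i : 1
    exact hrun.lam_zero i
  · ext i : 1
    exact hrun.lam_succ k i
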